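/- Let $\mathcal A,\mathcal B$ be unital $C^*$-algebras, let $X$ be a set, and let $k$ be a kernel on $X$ with values in the space $\mathcal L(\mathcal A,\mathcal B)$ of bounded linear maps, that is, a map $k: X\times X\to\mathcal L(\mathcal A,\mathcal B)$. Define the adjoint kernel by $k^*(x,y)[a]=(k(y,x)[a^*])^*$. For unital $C^*$-algebras $\mathcal A,\mathcal C$, a kernel $K: X\times X\to\mathcal L(\mathcal A,\mathcal C)$ is called completely positive if $\sum_{i,j=1}^n c_i^*K(x_i,x_j)[a_i^*a_j]c_j\ge 0$ in $\mathcal C$ for every finite choice $(x_i,a_i,c_i)_{i=1}^n$ of elements of $X\times\mathcal A\times\mathcal C$. An $(\mathcal A,\mathcal B)$-correspondence is a (complete) right Hilbert $C^*$-module $E$ over $\mathcal B$, with $\mathcal B$-valued inner product $\langle\cdot,\cdot\rangle$ linear in the first variable, together with a unital $*$-homomorphism from $\mathcal A$ to the $C^*$-algebra $\mathcal L^a(E)$ of adjointable operators on $E$, written as a left action. A Kolmogorov decomposition of $k$ is a triple $(E,J,\iota)$ where $E$ is an $(\mathcal A,\mathcal B)$-correspondence, $J\in\mathcal L^a(E)$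 is a contractive left $\mathcal A$-module map (not necessarily self-adjoint), and $\iota: X\to E$ is a map with $$k(x,y)[a]=\langle a\cdot\iota(y),\,J(\iota(x))\rangle\qquad\text{for all }x,y\in X,\ a\in\mathcal A.$$ Lemma. The kernel $k$ has a Kolmogorov decomposition if and only if there exist completely positive kernels $L_1,L_2: X\times X\to\mathcal L(\mathcal A,\mathcal B)$ such that $$(x,y)\mapsto\begin{pmatrix}L_1(x,y)&k(x,y)\\ k^*(x,y)&L_2(x,y)\end{pmatrix}:\mathcal A\to M_2(\mathcal B)$$ is a completely positive kernel. -/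

import Mathlib

open scoped InnerProductSpace

universe u v w t

/-- Kernels on `X` with values in the bounded linear maps `A → B`. -/
abbrev CStarKernel (X A B : Type*) [CStarAlgebra A] [CStarAlgebra B] :=
  X → X → A →L[ℂ] B

namespace CStarKernel

section Basic

variable {X A B : Type*} [CStarAlgebra A] [CStarAlgebra B]

/-- The adjoint kernel `k⋆(x, y)[a] = (k(y, x)[a⋆])⋆`. -/
noncomputable def adjoint (k : CStarKernel X A B) : CStarKernel X A B := fun x y =>
  ((starL ℂ : B ≃L⋆[ℂ] B) : B →L⋆[ℂ] B).comp
    ((k y x).comp ((starL ℂ : A ≃L⋆[ℂ] A) : A →L⋆[ℂ] A))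

theorem adjoint_apply (k : CStarKernel X A B) (x y : X) (a : A) :
    adjoint k x y a = star (k y x (star a)) := rfl

/-- A kernel is completely positive if `∑ᵢⱼ bᵢ⋆ k(xᵢ, xⱼ)[aᵢ⋆ aⱼ] bⱼ ≥ 0` for every finite choice
of elements of `X × A × B`. -/
def IsCompletelyPositive [PartialOrder B] (k : CStarKernel X A B) : Prop :=
  ∀ (n : ℕ) (x : Fin n → X) (a : Fin n → A) (b : Fin n → B),
    0 ≤ ∑ i, ∑ j, star (b i) * k (x i) (x j) (star (a i) * a j) * b j

variable [PartialOrder B] [StarOrderedRing B]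

/-- The kernel with values in the bounded linear maps `A → M₂(B)` whose entries are the kernels
`k₁₁, k₁₂, k₂₁, k₂₂`. Here `M₂(B)` carries its C⋆-norm and C⋆-order. -/
noncomputable def block (k₁₁ k₁₂ k₂₁ k₂₂ : CStarKernel X A B) :
    CStarKernel X A (CStarMatrix (Fin 2) (Fin 2) B) := fun x y =>
  (CStarMatrix.ofMatrixL : Matrix (Fin 2) (Fin 2) B ≃L[ℂ] CStarMatrix (Fin 2) (Fin 2) B)
    |>.toContinuousLinearMap.comp
      (ContinuousLinearMap.pi fun p => ContinuousLinearMap.pi fun q =>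
        !![k₁₁ x y, k₁₂ x y; k₂₁ x y, k₂₂ x y] p q)

theorem block_apply (k₁₁ k₁₂ k₂₁ k₂₂ : CStarKernel X A B) (x y : X) (a : A) :
    block k₁₁ k₁₂ k₂₁ k₂₂ x y a =
      CStarMatrix.ofMatrix !![k₁₁ x y a, k₁₂ x y a; k₂₁ x y a, k₂₂ x y a] := by
  ext p q
  fin_cases p <;> fin_cases q <;> rfl

end Basic

end CStarKernel

section Correspondence

variable {B E : Type*} [CStarAlgebra B] [PartialOrder B]
  [NormedAddCommGroup E] [NormedSpace ℂ E] [Module Bᵐᵒᵖ E] [CStarModule Bᵐᵒᵖ E]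

variable (B) in
/-- The `B`-valued inner product `⟨x, y⟩` of a right Hilbert C⋆-module over `B`, linear in the first
variable: `⟨x · b, y⟩ = ⟨x, y⟩ b` and `⟨x, y⟩⋆ = ⟨y, x⟩`.

As everywhere in Mathlib, the right action of `B` is an action of `Bᵐᵒᵖ`, and Mathlib's inner product
`⟪y, x⟫_Bᵐᵒᵖ` is linear in the second variable and has its values in `Bᵐᵒᵖ`. -/
def rightInner (x y : E) : B := MulOpposite.unop ⟪y, x⟫_Bᵐᵒᵖ

theorem rightInner_op_smul_left (b : B) (x y : E) :
    rightInner B (MulOpposite.op b • x) y = rightInner B x y * b := by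
  simp [rightInner]

theorem star_rightInner (x y : E) : star (rightInner B x y) = rightInner B y x := by
  simp [rightInner, ← MulOpposite.unop_star]

theorem rightInner_smul_left (z : ℂ) (x y : E) :
    rightInner B (z • x) y = z • rightInner B x y := by
  simp [rightInner]

theorem rightInner_self_nonneg (x : E) : 0 ≤ rightInner B x x :=
  CStarModule.inner_self_nonneg (A := Bᵐᵒᵖ) (x := x)

variable (B) in
/-- `J` is adjointable: it has an adjoint for the `B`-valued inner product. -/
def IsAdjointable (J : E →L[ℂ] E) : Prop :=
  ∃ J' : E → E, ∀ x y : E, rightInner B (J x) y = rightInner B x (J' y)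

end Correspondence

/-- The right Hilbert C⋆-module `E` over `B` is an `(A, B)`-correspondence: it is complete and
carries a unital left action of `A` by adjointable operators, compatible with the complex scalars,
such that the adjoint of the action of `a` is the action of `a⋆`. -/
class CStarCorrespondence (A B E : Type*) [CStarAlgebra A] [CStarAlgebra B] [PartialOrder B]
    [NormedAddCommGroup E] [NormedSpace ℂ E] [Module Bᵐᵒᵖ E] [CStarModule Bᵐᵒᵖ E] [Module A E] :
    Prop extends CompleteSpace E, IsScalarTower ℂ A E where
  rightInner_smul (a : A) (x y : E) : rightInner B (a • x) y = rightInner B x (star a • y)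

/-- The kernel `k` has a Kolmogorov decomposition `(E, J, ι)`: `E` is an `(A, B)`-correspondence,
`J` is an adjointable contractive left `A`-module map on `E` and `ι : X → E` satisfies
`k(x, y)[a] = ⟨a · ι(y), J(ι(x))⟩`. The carrier of `E` lives in the universe `t`. -/
def CStarKernel.HasKolmogorovDecomposition {X : Type u} {A : Type v} {B : Type w}
    [CStarAlgebra A] [CStarAlgebra B] [PartialOrder B] (k : CStarKernel X A B) : Prop :=
  ∃ (E : Type t) (_ : NormedAddCommGroup E) (_ : NormedSpace ℂ E) (_ : Module Bᵐᵒᵖ E)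
    (_ : CStarModule Bᵐᵒᵖ E) (_ : Module A E) (_ : CStarCorrespondence A B E)
    (J : E →L[ℂ] E) (ι : X → E),
    IsAdjointable B J ∧ ‖J‖ ≤ 1 ∧ (∀ (a : A) (e : E), J (a • e) = a • J e) ∧
      ∀ (x y : X) (a : A), k x y a = rightInner B (a • ι y) (J (ι x))

/-!
Suppose first that `k(x, y)[a] = ⟨a · ι(y), J(ι(x))⟩`. The block kernel with the diagonal entries
`L₁(x, y)[a] = ⟨a · J(ι(y)), J(ι(x))⟩` and `L₂(x, y)[a] = ⟨a · ι(y), ι(x)⟩` has the `(p, q)` entry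
`⟨a · h_q(y), h_p(x)⟩`, where `h₀ = J ∘ ι` and `h₁ = ι`. Hence each sum in the definition of complete
positivity is a Gram matrix over `B`, and Gram matrices are positive (`CStarMatrix.gram_nonneg`): a
self-adjoint matrix `G` with a nonzero negative part `D` has the conjugate `D G D = -D³`, some
diagonal entry of which is not positive, whereas the diagonal entries of a conjugate of a Gram matrix
have the form `⟨v, v⟩`.

Conversely, the entries of a completely positive block kernel form a completely positive `B`-valued
kernel `L` on `X × Fin 2` (`CStarKernel.IsCompletelyPositive.entries`). Such a kernel has the form
`L(s, t)[a] = ⟨a · ι(t), ι(s)⟩` for a map `ι` into a correspondence `E`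
(`CStarKernel.IsCompletelyPositive.exists_correspondence`): the functions `(X × Fin 2) × A → B` of
finite support carry a semi-definite inner product defined by `L`, on which `A` acts by left
translation, and `E` is their completion. Mathlib's Hilbert C⋆-modules are definite from the start, so
the seminorm and the completion are treated through `PreCStarModule`. Finally, with `f = ι(·, 0)` and
`g = ι(·, 1)` one has `k(x, y)[a] = ⟨a · g(y), f(x)⟩`, and the module `E ⊕ E`, the map
`x ↦ (f(x), g(x))` and the shift `(u, v) ↦ (0, u)` are a Kolmogorov decomposition of `k`
(`CStarKernel.hasKolmogorovDecomposition_of_rightInner`).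
-/

/-! ### Positivity in C⋆-algebras and in matrix algebras over them -/

section Positivity

/-- Applied to `a ↦ ⟨a · e, e⟩`, this bounds a left action by adjointable operators: the inequality
`⟨a · e, a · e⟩ ≤ ‖a‖² ⟨e, e⟩` needs no continuity of `a ↦ ⟨a · e, e⟩`. -/
theorem LinearMap.map_star_mul_self_le {A B : Type*} [CStarAlgebra A] [CStarAlgebra B]
    [PartialOrder B] [StarOrderedRing B] (φ : A →ₗ[ℂ] B) (hφ : ∀ c, 0 ≤ φ (star c * c)) (a : A) :
    φ (star a * a) ≤ ‖a‖ ^ 2 • φ 1 := by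
  -- `A` carries no order, so `a⋆a ≤ ‖a‖² · 1` is taken in the spectral order.
  let _ := CStarAlgebra.spectralOrder A
  have := CStarAlgebra.spectralOrderedRing A
  obtain ⟨c, hc⟩ := CStarAlgebra.nonneg_iff_eq_star_mul_self.mp
    (sub_nonneg.mpr (CStarAlgebra.star_mul_le_algebraMap_norm_sq (a := a)))
  have h := hφ c
  rw [← hc, map_sub, Algebra.algebraMap_eq_smul_one, LinearMap.map_smul_of_tower] at h
  exact sub_nonneg.mp h

/-- A self-adjoint element is positive if no conjugate of it is negative and nonzero: the conjugate
by the negative part `G⁻` is `-(G⁻)³`. -/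
theorem CStarAlgebra.nonneg_of_forall_conjugate_eq_neg {M : Type*} [CStarAlgebra M]
    [PartialOrder M] [StarOrderedRing M] {G : M} (hG : IsSelfAdjoint G)
    (h : ∀ D Y : M, star D * G * D = -(star Y * Y) → Y = 0) : 0 ≤ G := by
  rw [← CFC.negPart_eq_zero_iff G]
  set D := G⁻ with hD
  have hD0 : 0 ≤ D := CFC.negPart_nonneg G
  have hDs : star D = D := (IsSelfAdjoint.of_nonneg hD0).star_eq
  obtain ⟨R, hR⟩ := CStarAlgebra.nonneg_iff_eq_star_mul_self.mp hD0
  have hRD : R * D = 0 := by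
    refine h D _ ?_
    have h1 : G = G⁺ - D := (CFC.posPart_sub_negPart G hG).symm
    have h2 : D * G⁺ = 0 := CFC.negPart_mul_posPart G
    calc star D * G * D = D * (G⁺ - D) * D := by rw [hDs, ← h1]
      _ = -(D * D * D) := by rw [mul_sub, h2, zero_sub, neg_mul]
      _ = -(star (R * D) * (R * D)) := by
        rw [star_mul, hDs]
        nth_rw 2 [hR]
        simp only [mul_assoc]
  rw [← CStarRing.star_mul_self_eq_zero_iff, hDs]
  nth_rw 1 [hR]
  rw [mul_assoc, hRD, mul_zero]

/-- Stated for an abstract C⋆-algebra, so that for `CStarMatrix` the functional calculus is found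
through the `CStarAlgebra` instance. -/
theorem CStarAlgebra.exists_eq_star_mul_self {M : Type*} [CStarAlgebra M]
    [PartialOrder M] [StarOrderedRing M] {a : M} (ha : 0 ≤ a) : ∃ b, a = star b * b :=
  CStarAlgebra.nonneg_iff_eq_star_mul_self.mp ha

theorem CStarMatrix.sum_apply {ι m n B : Type*} [AddCommMonoid B] (s : Finset ι)
    (M : ι → CStarMatrix m n B) (p : m) (q : n) : (∑ i ∈ s, M i) p q = ∑ i ∈ s, M i p q :=
  Matrix.sum_apply p q s M

/-- The diagonal entries of `star Y * Y` are sums of elements `star y * y`, so if all of them vanish,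
then `Y = 0`. -/
theorem CStarMatrix.nonneg_of_diagonal_nonneg {n B : Type*} [Fintype n] [DecidableEq n]
    [CStarAlgebra B] [PartialOrder B] [StarOrderedRing B] {G : CStarMatrix n n B}
    (hG : IsSelfAdjoint G) (h : ∀ (D : CStarMatrix n n B) (q : n), 0 ≤ (star D * G * D) q q) :
    0 ≤ G := by
  refine CStarAlgebra.nonneg_of_forall_conjugate_eq_neg hG fun D Y hDY => ?_
  ext p q
  have h3 := h D q
  rw [hDY, CStarMatrix.neg_apply, CStarMatrix.mul_apply, Left.nonneg_neg_iff] at h3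
  simp only [CStarMatrix.star_apply] at h3
  have h4 : ∀ r ∈ Finset.univ, 0 ≤ star (Y r q) * Y r q := fun r _ => star_mul_self_nonneg _
  exact (CStarRing.star_mul_self_eq_zero_iff _).mp
    ((Finset.sum_eq_zero_iff_of_nonneg h4).mp (le_antisymm h3 (Finset.sum_nonneg h4)) p
      (Finset.mem_univ p))

theorem CStarMatrix.diagonal_nonneg {n B : Type*} [Fintype n] [DecidableEq n]
    [CStarAlgebra B] [PartialOrder B] [StarOrderedRing B] {G : CStarMatrix n n B}
    (hG : 0 ≤ G) (q : n) : 0 ≤ G q q := by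
  obtain ⟨R, rfl⟩ := CStarAlgebra.exists_eq_star_mul_self hG
  rw [CStarMatrix.mul_apply]
  exact Finset.sum_nonneg fun r _ => by
    rw [CStarMatrix.star_apply]; exact star_mul_self_nonneg _

end Positivity

/-! ### Gram matrices in Hilbert C⋆-modules -/

section RightInner

variable {B E : Type*} [CStarAlgebra B] [PartialOrder B]
  [NormedAddCommGroup E] [NormedSpace ℂ E] [Module Bᵐᵒᵖ E] [CStarModule Bᵐᵒᵖ E]

theorem rightInner_op_smul_right (b : B) (x y : E) :
    rightInner B x (MulOpposite.op b • y) = star b * rightInner B x y := by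
  simp [rightInner]

theorem rightInner_add_left (x y z : E) :
    rightInner B (x + y) z = rightInner B x z + rightInner B y z := by
  simp [rightInner]

theorem rightInner_zero_left (x : E) : rightInner B 0 x = 0 := by
  simp [rightInner]

theorem rightInner_zero_right (x : E) : rightInner B x 0 = 0 := by
  simp [rightInner]

theorem rightInner_sum_left {ι : Type*} (s : Finset ι) (f : ι → E) (z : E) :
    rightInner B (∑ i ∈ s, f i) z = ∑ i ∈ s, rightInner B (f i) z := by
  simp [rightInner]

theorem rightInner_sum_right {ι : Type*} (s : Finset ι) (f : ι → E) (z : E) :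
    rightInner B z (∑ i ∈ s, f i) = ∑ i ∈ s, rightInner B z (f i) := by
  simp [rightInner]

theorem norm_rightInner_self (x : E) : ‖rightInner B x x‖ = ‖x‖ ^ 2 :=
  (CStarModule.norm_sq_eq Bᵐᵒᵖ).symm

variable [StarOrderedRing B]

theorem norm_rightInner_le (x y : E) : ‖rightInner B x y‖ ≤ ‖x‖ * ‖y‖ :=
  (CStarModule.norm_inner_le (A := Bᵐᵒᵖ) E (x := y) (y := x)).trans_eq (mul_comm _ _)

/-- The diagonal entries of a conjugate `D⋆ G D` of the Gram matrix `G` are inner products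
`⟨v, v⟩`, where `v = ∑ₛ eₛ · D s q`. -/
theorem CStarMatrix.gram_nonneg {n : Type*} [Fintype n] [DecidableEq n] (e : n → E) :
    0 ≤ (CStarMatrix.ofMatrix fun p q => rightInner B (e q) (e p) : CStarMatrix n n B) := by
  refine CStarMatrix.nonneg_of_diagonal_nonneg ?_ fun D q => ?_
  · ext p q
    exact star_rightInner _ _
  · have : (star D * (CStarMatrix.ofMatrix fun p q => rightInner B (e q) (e p)) * D) q q =
        rightInner B (∑ s, MulOpposite.op (D s q) • e s) (∑ s, MulOpposite.op (D s q) • e s) := by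
      rw [CStarMatrix.mul_apply, rightInner_sum_left]
      refine Finset.sum_congr rfl fun s _ => ?_
      rw [CStarMatrix.mul_apply, rightInner_op_smul_left, rightInner_sum_right]
      congr 1
      refine Finset.sum_congr rfl fun r _ => ?_
      rw [rightInner_op_smul_right, CStarMatrix.star_apply]
      rfl
    rw [this]
    exact rightInner_self_nonneg _

end RightInner

/-! ### Completely positive kernels from a correspondence -/

section Correspondence

variable {X A B E : Type*} [CStarAlgebra A] [CStarAlgebra B] [PartialOrder B] [StarOrderedRing B]
  [NormedAddCommGroup E] [NormedSpace ℂ E] [Module Bᵐᵒᵖ E] [CStarModule Bᵐᵒᵖ E] [Module A E]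
  [CStarCorrespondence A B E]

namespace CStarCorrespondence

theorem norm_smul_le (B : Type*) [CStarAlgebra B] [PartialOrder B] [StarOrderedRing B]
    [Module Bᵐᵒᵖ E] [CStarModule Bᵐᵒᵖ E] [CStarCorrespondence A B E] (a : A) (e : E) :
    ‖a • e‖ ≤ ‖a‖ * ‖e‖ := by
  let φ : A →ₗ[ℂ] B :=
    { toFun := fun c => rightInner B (c • e) e
      map_add' := fun c d => by rw [add_smul, rightInner_add_left]
      map_smul' := fun z c => by rw [smul_assoc, rightInner_smul_left, RingHom.id_apply] }
  have hφ (c : A) : φ (star c * c) = rightInner B (c • e) (c • e) := by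
    change rightInner B ((star c * c) • e) e = _
    rw [mul_smul, rightInner_smul, star_star]
  have h1 : φ 1 = rightInner B e e := congrArg (rightInner B · e) (one_smul A e)
  have h := φ.map_star_mul_self_le (fun c => (hφ c).symm ▸ rightInner_self_nonneg _) a
  rw [hφ, h1] at h
  have h2 := CStarAlgebra.norm_le_norm_of_nonneg_of_le (rightInner_self_nonneg _) h
  rw [_root_.norm_smul, norm_rightInner_self, norm_rightInner_self, norm_pow, norm_norm, ← mul_pow]
    at h2
  exact (pow_le_pow_iff_left₀ (norm_nonneg _) (by positivity) two_ne_zero).mp h2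

variable (A B) in
/-- The kernel `(x, y) ↦ (a ↦ ⟨a · g(y), f(x)⟩)` of two maps into a correspondence. -/
noncomputable def kernel (f g : X → E) : CStarKernel X A B := fun x y =>
  LinearMap.mkContinuous
    { toFun := fun a => rightInner B (a • g y) (f x)
      map_add' := fun c d => by rw [add_smul, rightInner_add_left]
      map_smul' := fun z c => by rw [smul_assoc, rightInner_smul_left, RingHom.id_apply] }
    (‖g y‖ * ‖f x‖) fun a => by
      calc ‖rightInner B (a • g y) (f x)‖ ≤ ‖a • g y‖ * ‖f x‖ := norm_rightInner_le _ _
        _ ≤ ‖a‖ * ‖g y‖ * ‖f x‖ := by gcongr; exact norm_smul_le B a _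
        _ = ‖g y‖ * ‖f x‖ * ‖a‖ := by ring

theorem kernel_apply (f g : X → E) (x y : X) (a : A) :
    kernel A B f g x y a = rightInner B (a • g y) (f x) := rfl

theorem adjoint_kernel (f g : X → E) : (kernel A B f g).adjoint = kernel A B g f := by
  ext x y a
  rw [CStarKernel.adjoint_apply, kernel_apply, kernel_apply, star_rightInner, rightInner_smul]

theorem isCompletelyPositive_kernel (f : X → E) :
    (kernel A B f f).IsCompletelyPositive := by
  intro n x a b
  have : ∑ i, ∑ j, star (b i) * kernel A B f f (x i) (x j) (star (a i) * a j) * b j =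
      rightInner B (∑ j, MulOpposite.op (b j) • a j • f (x j))
        (∑ i, MulOpposite.op (b i) • a i • f (x i)) := by
    rw [rightInner_sum_right]
    refine Finset.sum_congr rfl fun i _ => ?_
    rw [rightInner_sum_left]
    refine Finset.sum_congr rfl fun j _ => ?_
    rw [rightInner_op_smul_right, rightInner_op_smul_left, kernel_apply, mul_smul,
      rightInner_smul, star_star, mul_assoc]
  rw [this]
  exact rightInner_self_nonneg _

/-- With `h₀ = f` and `h₁ = g`, the sum in the definition of complete positivity is the Gram matrix
of the two vectors `e q = ∑ⱼ ∑ₛ aⱼ · hₛ(xⱼ) · Cⱼ(s, q)`. -/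
theorem isCompletelyPositive_block_kernel (f g : X → E) :
    (CStarKernel.block (kernel A B f f) (kernel A B f g) (kernel A B g f)
      (kernel A B g g)).IsCompletelyPositive := by
  intro n x a C
  let h : Fin 2 → X → E := ![f, g]
  let e : Fin 2 → E := fun q => ∑ j, ∑ s, MulOpposite.op (C j s q) • a j • h s (x j)
  have hb (x y : X) (a : A) : CStarKernel.block (kernel A B f f) (kernel A B f g)
      (kernel A B g f) (kernel A B g g) x y a =
        CStarMatrix.ofMatrix fun p q => rightInner B (a • h q y) (h p x) := by
    rw [CStarKernel.block_apply]
    ext p q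
    fin_cases p <;> fin_cases q <;> rfl
  have he (p q : Fin 2) : (∑ i, ∑ j, star (C i) * CStarKernel.block (kernel A B f f)
      (kernel A B f g) (kernel A B g f) (kernel A B g g) (x i) (x j) (star (a i) * a j) * C j :
        CStarMatrix (Fin 2) (Fin 2) B) p q = rightInner B (e q) (e p) := by
    rw [CStarMatrix.sum_apply, rightInner_sum_right]
    refine Finset.sum_congr rfl fun i _ => ?_
    rw [CStarMatrix.sum_apply, rightInner_sum_left]
    refine Finset.sum_congr rfl fun j _ => ?_
    rw [hb, CStarMatrix.mul_apply, rightInner_sum_left]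
    refine Finset.sum_congr rfl fun s _ => ?_
    rw [CStarMatrix.mul_apply, rightInner_op_smul_left, rightInner_sum_right]
    congr 1
    refine Finset.sum_congr rfl fun r _ => ?_
    rw [rightInner_op_smul_right, CStarMatrix.star_apply, ← star_star (a i),
      ← rightInner_smul, smul_smul, star_star]
    rfl
  rw [show (∑ i, ∑ j, star (C i) * CStarKernel.block (kernel A B f f) (kernel A B f g)
    (kernel A B g f) (kernel A B g g) (x i) (x j) (star (a i) * a j) * C j :
      CStarMatrix (Fin 2) (Fin 2) B) = _ from CStarMatrix.ext he]
  exact CStarMatrix.gram_nonneg e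

end CStarCorrespondence
end Correspondence

/-- The diagonal kernels are those of `J ∘ ι` and of `ι`. -/
theorem CStarKernel.HasKolmogorovDecomposition.exists_block {X : Type u} {A : Type v} {B : Type w}
    [CStarAlgebra A] [CStarAlgebra B] [PartialOrder B] [StarOrderedRing B] {k : CStarKernel X A B}
    (hk : CStarKernel.HasKolmogorovDecomposition.{u, v, w, t} k) :
    ∃ L₁ L₂ : CStarKernel X A B, L₁.IsCompletelyPositive ∧ L₂.IsCompletelyPositive ∧
      (CStarKernel.block L₁ k (CStarKernel.adjoint k) L₂).IsCompletelyPositive := by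
  obtain ⟨E, _, _, _, _, _, _, J, ι, -, -, -, hk⟩ := hk
  have hk' : k = CStarCorrespondence.kernel A B (fun x => J (ι x)) ι := by
    ext x y a
    exact hk x y a
  refine ⟨_, _, CStarCorrespondence.isCompletelyPositive_kernel fun x => J (ι x),
    CStarCorrespondence.isCompletelyPositive_kernel ι, ?_⟩
  rw [hk', CStarCorrespondence.adjoint_kernel]
  exact CStarCorrespondence.isCompletelyPositive_block_kernel _ _

/-! ### Completion of a module with a semi-definite C⋆-valued inner product -/

/-- A `CStarModule` without definiteness: the inner product may vanish at `(x, x)` for `x ≠ 0`, and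
`‖x‖ = √‖⟪x, x⟫‖` is only a seminorm. -/
class PreCStarModule (C E : Type*) [CStarAlgebra C] [PartialOrder C] [AddCommGroup E]
    [Module ℂ E] [Module C E] [Norm E] extends Inner C E where
  inner_add_right (x y z : E) : inner x (y + z) = inner x y + inner x z
  inner_self_nonneg (x : E) : 0 ≤ inner x x
  inner_smul_right (c : C) (x y : E) : inner x (c • y) = c * inner x y
  inner_smul_right_complex (z : ℂ) (x y : E) : inner x (z • y) = z • inner x y
  star_inner (x y : E) : star (inner x y) = inner y x
  norm_eq_sqrt_norm_inner_self (x : E) : ‖x‖ = √‖inner x x‖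

namespace PreCStarModule

section Norm

variable {C E : Type*} [CStarAlgebra C] [PartialOrder C] [AddCommGroup E]
  [Module ℂ E] [Module C E] [Norm E] [PreCStarModule C E]

theorem inner_add_left (x y z : E) : ⟪x + y, z⟫_C = ⟪x, z⟫_C + ⟪y, z⟫_C := by
  rw [← star_inner, inner_add_right, star_add, star_inner, star_inner]

theorem inner_smul_left (c : C) (x y : E) : ⟪c • x, y⟫_C = ⟪x, y⟫_C * star c := by
  rw [← star_inner, inner_smul_right, star_mul, star_inner]

theorem inner_smul_left_complex (z : ℂ) (x y : E) : ⟪z • x, y⟫_C = star z • ⟪x, y⟫_C := by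
  rw [← star_inner, inner_smul_right_complex, star_smul, star_inner]

variable (C E) in
/-- The inner product as a sesquilinear map, conjugate linear in the first variable. -/
noncomputable def innerₛₗ : E →ₗ⋆[ℂ] E →ₗ[ℂ] C :=
  LinearMap.mk₂'ₛₗ _ _ (fun x y => ⟪x, y⟫_C) inner_add_left inner_smul_left_complex
    inner_add_right fun z x y => inner_smul_right_complex z x y

theorem inner_sub_left (x y z : E) : ⟪x - y, z⟫_C = ⟪x, z⟫_C - ⟪y, z⟫_C :=
  (innerₛₗ C E).map_sub₂ x y z

theorem inner_sub_right (x y z : E) : ⟪x, y - z⟫_C = ⟪x, y⟫_C - ⟪x, z⟫_C :=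
  map_sub (innerₛₗ C E x) y z

variable (C) in
theorem norm_sq_eq (x : E) : ‖x‖ ^ 2 = ‖⟪x, x⟫_C‖ := by
  rw [norm_eq_sqrt_norm_inner_self (C := C), Real.sq_sqrt (norm_nonneg _)]

variable (C) in
include C in
protected theorem norm_nonneg (x : E) : 0 ≤ ‖x‖ := by
  rw [norm_eq_sqrt_norm_inner_self (C := C)]; positivity

theorem norm_smul_le (c : C) (x : E) : ‖c • x‖ ≤ ‖c‖ * ‖x‖ := by
  refine (pow_le_pow_iff_left₀ (PreCStarModule.norm_nonneg C _)
    (mul_nonneg (norm_nonneg _) (PreCStarModule.norm_nonneg C _)) two_ne_zero).mp ?_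
  rw [norm_sq_eq C, mul_pow, norm_sq_eq C x, inner_smul_left, inner_smul_right]
  calc ‖c * ⟪x, x⟫_C * star c‖ ≤ ‖c‖ * ‖⟪x, x⟫_C‖ * ‖star c‖ :=
        (norm_mul_le _ _).trans (mul_le_mul_of_nonneg_right (norm_mul_le _ _) (norm_nonneg _))
    _ = _ := by rw [norm_star]; ring

variable [StarOrderedRing C]

/-- The Cauchy–Schwarz inequality with a strict upper bound `r` of `‖⟪x, x⟫‖` in the place of
`‖x‖ ^ 2`. The proof divides by `r`, and for a semi-definite inner product `‖x‖` may be zero while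
`x` is not. -/
theorem inner_mul_inner_swap_le (x y : E) {r : ℝ} (hr : ‖⟪x, x⟫_C‖ < r) :
    ⟪x, y⟫_C * ⟪y, x⟫_C ≤ r • ⟪y, y⟫_C := by
  have hr0 : 0 < r := (norm_nonneg _).trans_lt hr
  set a := ⟪x, y⟫_C with ha
  have hay : ⟪y, x⟫_C = star a := (star_inner x y).symm
  have h0 : 0 ≤ ⟪a • x - (r : ℂ) • y, a • x - (r : ℂ) • y⟫_C := inner_self_nonneg _
  have h1 : ⟪a • x - (r : ℂ) • y, a • x - (r : ℂ) • y⟫_C =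
      a * (⟪x, x⟫_C * star a) - r • (a * star a) - r • (a * star a) + r • r • ⟪y, y⟫_C := by
    simp only [inner_sub_left, inner_sub_right, inner_smul_left, inner_smul_right,
      inner_smul_left_complex, inner_smul_right_complex, hay, ← ha, Complex.star_def,
      Complex.conj_ofReal]
    simp only [Complex.coe_smul, mul_smul_comm, mul_sub, smul_sub]
    abel
  have h2 : a * (⟪x, x⟫_C * star a) ≤ r • (a * star a) := by
    have hx : IsSelfAdjoint ⟪x, x⟫_C := star_inner x x
    rw [← mul_assoc]
    exact (CStarAlgebra.star_right_conjugate_le_norm_smul (a := a)).trans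
      (smul_le_smul_of_nonneg_right hr.le (mul_star_self_nonneg a))
  rw [h1] at h0
  have h3 : r • (a * star a) ≤ r • r • ⟪y, y⟫_C := by
    rw [← sub_nonneg]
    refine h0.trans ?_
    rw [← sub_nonneg] at h2 ⊢
    refine h2.trans_eq ?_
    abel
  rw [hay]
  exact (smul_le_smul_iff_of_pos_left hr0).mp h3

variable (C) in
theorem norm_inner_le (x y : E) : ‖⟪x, y⟫_C‖ ≤ ‖x‖ * ‖y‖ := by
  have h : ‖⟪x, y⟫_C‖ ^ 2 ≤ ‖⟪x, x⟫_C‖ * ‖⟪y, y⟫_C‖ := by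
    have h1 (r : ℝ) (hr : ‖⟪x, x⟫_C‖ < r) : ‖⟪x, y⟫_C‖ ^ 2 ≤ r * ‖⟪y, y⟫_C‖ := by
      have hr0 : 0 ≤ r := (norm_nonneg _).trans hr.le
      have h2 := inner_mul_inner_swap_le x y hr
      rw [← star_inner x y] at h2
      have h3 := CStarAlgebra.norm_le_norm_of_nonneg_of_le (mul_star_self_nonneg _) h2
      rwa [CStarRing.norm_self_mul_star, ← pow_two, norm_smul, Real.norm_of_nonneg hr0] at h3
    -- Let `r` decrease to `‖⟪x, x⟫‖`.
    refine ge_of_tendsto ((continuous_id.mul continuous_const).continuousWithinAt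
      (s := Set.Ioi ‖⟪x, x⟫_C‖)) ?_
    exact Filter.eventually_of_mem self_mem_nhdsWithin h1
  rw [← norm_sq_eq C, ← norm_sq_eq C, ← mul_pow] at h
  exact (pow_le_pow_iff_left₀ (norm_nonneg _)
    (mul_nonneg (PreCStarModule.norm_nonneg C x) (PreCStarModule.norm_nonneg C y))
    two_ne_zero).mp h

variable (C E) in
include C in
theorem seminormedSpaceCore : SeminormedSpace.Core ℂ E where
  norm_nonneg := PreCStarModule.norm_nonneg C
  norm_smul z x := by
    simp only [norm_eq_sqrt_norm_inner_self (C := C), inner_smul_left_complex,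
      inner_smul_right_complex, norm_smul, ← mul_assoc]
    simp
  norm_triangle x y := by
    have hx := PreCStarModule.norm_nonneg C x
    have hy := PreCStarModule.norm_nonneg C y
    refine (pow_le_pow_iff_left₀ (PreCStarModule.norm_nonneg C _) (by positivity)
      two_ne_zero).mp ?_
    rw [norm_sq_eq C, inner_add_left, inner_add_right, inner_add_right]
    calc _ ≤ (‖⟪x, x⟫_C‖ + ‖⟪x, y⟫_C‖) + (‖⟪y, x⟫_C‖ + ‖⟪y, y⟫_C‖) :=
          (norm_add_le _ _).trans (add_le_add (norm_add_le _ _) (norm_add_le _ _))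
      _ ≤ (‖x‖ * ‖x‖ + ‖x‖ * ‖y‖) + (‖y‖ * ‖x‖ + ‖y‖ * ‖y‖) := by
          gcongr <;> exact norm_inner_le C _ _
      _ = (‖x‖ + ‖y‖) ^ 2 := by ring

end Norm

section Completion

open UniformSpace

variable {C E : Type*} [CStarAlgebra C] [PartialOrder C] [StarOrderedRing C]
  [SeminormedAddCommGroup E] [NormedSpace ℂ E] [Module C E] [PreCStarModule C E]

instance : UniformContinuousConstSMul C E :=
  have := IsBoundedSMul.of_norm_smul_le (norm_smul_le (C := C) (E := E))
  inferInstance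

theorem continuous_inner : Continuous (Function.uncurry (inner C : E → E → C)) := by
  let f : E →L⋆[ℂ] E →L[ℂ] C := (innerₛₗ C E).mkContinuous₂ 1 fun x y => by
    rw [one_mul]; exact norm_inner_le C x y
  exact (f.continuous.comp continuous_fst).clm_apply continuous_snd

theorem inner_coe (x y : E) : ⟪(x : Completion E), (y : Completion E)⟫_C = ⟪x, y⟫_C :=
  (Completion.isDenseInducing_coe.prodMap Completion.isDenseInducing_coe).extend_eq
    (continuous_inner (C := C) (E := E)) (x, y)

theorem continuous_inner_completion :
    Continuous (Function.uncurry (inner C : Completion E → Completion E → C)) := by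
  let inner' : E →+ E →+ C :=
    { toFun := fun x => (innerₛₗ C E x).toAddMonoidHom
      map_zero' := by ext y; exact DFunLike.congr_fun (map_zero (innerₛₗ C E)) y
      map_add' := fun x y => by ext z; exact inner_add_left x y z }
  have : Continuous fun p : E × E => inner' p.1 p.2 := continuous_inner
  exact (Completion.isDenseInducing_toCompl E).extend_Z_bilin
    (Completion.isDenseInducing_toCompl E) this

theorem continuous_inner_completion_comp {α : Type*} [TopologicalSpace α]
    {f g : α → Completion E} (hf : Continuous f) (hg : Continuous g) :
    Continuous fun x => ⟪f x, g x⟫_C :=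
  (continuous_inner_completion (C := C) (E := E)).comp (hf.prodMk hg)

theorem norm_eq_sqrt_norm_inner_completion (x : Completion E) : ‖x‖ = √‖⟪x, x⟫_C‖ :=
    Completion.induction_on x (isClosed_eq continuous_norm
      (continuous_inner_completion_comp continuous_id continuous_id).norm.sqrt) fun x => by
      rw [inner_coe, Completion.norm_coe, norm_eq_sqrt_norm_inner_self (C := C)]

/-- The Hilbert C⋆-module obtained from `E` by dividing out the vectors of length zero and
completing. -/
noncomputable instance : CStarModule C (Completion E) where
  inner_add_right {x y z} :=
    Completion.induction_on₃ x y z (isClosed_eq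
      (continuous_inner_completion_comp (by fun_prop) (by fun_prop))
      ((continuous_inner_completion_comp (by fun_prop) (by fun_prop)).add
        (continuous_inner_completion_comp (by fun_prop) (by fun_prop)))) fun x y z => by
      rw [← Completion.coe_add, inner_coe, inner_coe, inner_coe, inner_add_right]
  inner_self_nonneg {x} :=
    Completion.induction_on x (isClosed_le continuous_const
      (continuous_inner_completion_comp continuous_id continuous_id)) fun x => by
      rw [inner_coe]; exact inner_self_nonneg x
  inner_self {x} := by
    rw [← norm_eq_zero (a := x), norm_eq_sqrt_norm_inner_completion (C := C),
      Real.sqrt_eq_zero (norm_nonneg _), norm_eq_zero]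
  inner_op_smul_right {c x y} :=
    Completion.induction_on₂ x y (isClosed_eq
      (continuous_inner_completion_comp continuous_fst (continuous_snd.const_smul c))
      ((continuous_inner_completion_comp continuous_fst continuous_snd).const_mul c))
      fun x y => by
        rw [← Completion.coe_smul, inner_coe, inner_coe, inner_smul_right]
  inner_smul_right_complex {z x y} :=
    Completion.induction_on₂ x y (isClosed_eq
      (continuous_inner_completion_comp continuous_fst (continuous_snd.const_smul z))
      ((continuous_inner_completion_comp continuous_fst continuous_snd).const_smul z))
      fun x y => by
        rw [← Completion.coe_smul, inner_coe, inner_coe, inner_smul_right_complex]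
  star_inner x y :=
    Completion.induction_on₂ x y (isClosed_eq
      (continuous_inner_completion_comp continuous_fst continuous_snd).star
      (continuous_inner_completion_comp continuous_snd continuous_fst)) fun x y => by
      rw [inner_coe, inner_coe, star_inner]
  norm_eq_sqrt_norm_inner_self := norm_eq_sqrt_norm_inner_completion

end Completion

end PreCStarModule

/-! ### The correspondence of a completely positive kernel -/

/-- Polarization: a positive sesquilinear form is Hermitian. -/
theorem LinearMap.star_apply_of_nonneg {V C : Type*} [AddCommGroup V] [Module ℂ V]
    [CStarAlgebra C] [PartialOrder C] [StarOrderedRing C] (G : V →ₗ⋆[ℂ] V →ₗ[ℂ] C)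
    (hG : ∀ v, 0 ≤ G v v) (v w : V) : star (G v w) = G w v := by
  have hs (u : V) : star (G u u) = G u u := (IsSelfAdjoint.of_nonneg (hG u)).star_eq
  have h1 := hs (v + w)
  have h2 := hs (v + Complex.I • w)
  simp only [map_add, map_smulₛₗ, LinearMap.add_apply, LinearMap.smul_apply, star_add, star_smul,
    hs v, hs w, Complex.star_def, Complex.conj_I, RingHom.id_apply, map_neg, smul_add] at h1 h2
  have h3 : star (G v w) + star (G w v) = G v w + G w v := by
    rw [← sub_eq_zero] at h1 ⊢
    rw [← h1]; abel
  have h4 : -Complex.I • (star (G v w) - star (G w v)) = Complex.I • (G v w - G w v) := by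
    rw [← sub_eq_zero] at h2 ⊢
    rw [← h2]; module
  have h5 : star (G v w) - star (G w v) = -(G v w - G w v) := by
    have := congrArg (Complex.I • ·) h4
    simpa [smul_smul] using this
  have h6 : (2 : ℂ) • star (G v w) = (2 : ℂ) • G w v := by
    calc (2 : ℂ) • star (G v w) = (star (G v w) + star (G w v)) +
          (star (G v w) - star (G w v)) := by module
      _ = (2 : ℂ) • G w v := by rw [h3, h5]; module
  exact smul_right_injective C (two_ne_zero (α := ℂ)) h6

namespace CStarKernel

open MulOpposite UniformSpace

variable {Y A B : Type*} [CStarAlgebra A] [CStarAlgebra B]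

/-- The sesquilinear form on finitely supported functions `Y × A → B` with
`⟨δ₍x, a₎ b, δ₍y, a'₎ c⟩ = b⋆ L(x, y)[a⋆ a'] c`. It is conjugate linear in the first variable, and the
function `δ₍x, a₎ b` stands for `a · ι(x) · b`. -/
noncomputable def gramForm (L : CStarKernel Y A B) :
    (Y × A →₀ B) →ₗ⋆[ℂ] (Y × A →₀ B) →ₗ[ℂ] B :=
  LinearMap.mk₂'ₛₗ _ _
    (fun v w => v.sum fun s b => w.sum fun t c => star b * L s.1 t.1 (star s.2 * t.2) * c)
    (fun v v' w => Finsupp.sum_add_index' (by simp) (by simp [add_mul, Finsupp.sum_add]))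
    (fun z v w => (Finsupp.sum_smul_index' (by simp)).trans
      (by simp [Finsupp.smul_sum]))
    (fun v w w' => by
      rw [← Finsupp.sum_add]
      exact Finsupp.sum_congr fun s _ => Finsupp.sum_add_index' (by simp) (by simp [mul_add]))
    (fun z v w => by
      rw [Finsupp.smul_sum]
      refine Finsupp.sum_congr fun s _ => (Finsupp.sum_smul_index' (by simp)).trans ?_
      simp [Finsupp.smul_sum])

section GramForm

variable (L : CStarKernel Y A B) (v w : Y × A →₀ B)

theorem gramForm_apply : gramForm L v w =
    v.sum fun s b => w.sum fun t c => star b * L s.1 t.1 (star s.2 * t.2) * c := rfl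

theorem gramForm_single_single (s t : Y × A) (b c : B) :
    gramForm L (Finsupp.single s b) (Finsupp.single t c) =
      star b * L s.1 t.1 (star s.2 * t.2) * c := by
  rw [gramForm_apply, Finsupp.sum_single_index (by simp), Finsupp.sum_single_index (by simp)]

theorem gramForm_op_smul_right (c : B) :
    gramForm L v (op c • w) = gramForm L v w * c := by
  rw [gramForm_apply, gramForm_apply, Finsupp.sum_mul]
  refine Finsupp.sum_congr fun s _ => (Finsupp.sum_smul_index' (by simp)).trans ?_
  rw [Finsupp.sum_mul]
  exact Finsupp.sum_congr fun t _ => by rw [op_smul_eq_mul, mul_assoc, mul_assoc, mul_assoc]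

theorem gramForm_self_nonneg [PartialOrder B] (hL : L.IsCompletelyPositive) :
    0 ≤ gramForm L v v := by
  let e := v.support.equivFin.symm
  have h := hL v.support.card (fun i => (e i).1.1) (fun i => (e i).1.2) (fun i => v (e i).1)
  have hsum (f : Y × A → B) : ∑ i, f (e i).1 = ∑ s ∈ v.support, f s :=
    (e.sum_comp fun s => f s.1).trans (Finset.sum_coe_sort v.support f)
  rw [hsum fun s => ∑ j, star (v s) * L s.1 (e j).1.1 (star s.2 * (e j).1.2) * v (e j).1] at h
  refine h.trans_eq (Finset.sum_congr rfl fun s _ => ?_)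
  exact hsum fun t => star (v s) * L s.1 t.1 (star s.2 * t.2) * v t

variable (Y B) in
/-- The action of `a` on functions: it moves the value at `(y, a')` to `(y, a * a')`. It is
multiplicative in `a`; additive it becomes only modulo vectors of length zero. -/
noncomputable def leftTranslate (a : A) : (Y × A →₀ B) →ₗ[ℂ] (Y × A →₀ B) :=
  Finsupp.lmapDomain B ℂ fun s => (s.1, a * s.2)

theorem leftTranslate_apply (a : A) :
    leftTranslate Y B a v = v.mapDomain fun s => (s.1, a * s.2) := rfl

theorem leftTranslate_one : leftTranslate Y B 1 v = v := by
  simp only [leftTranslate_apply, one_mul]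
  exact Finsupp.mapDomain_id

theorem leftTranslate_mul (a a' : A) :
    leftTranslate Y B (a * a') v = leftTranslate Y B a (leftTranslate Y B a' v) := by
  simp only [leftTranslate_apply, ← Finsupp.mapDomain_comp, Function.comp_def, mul_assoc]

theorem gramForm_leftTranslate_right (a : A) : gramForm L v (leftTranslate Y B a w) =
    v.sum fun s b => w.sum fun t c => star b * L s.1 t.1 (star s.2 * (a * t.2)) * c := by
  rw [gramForm_apply, leftTranslate_apply]
  exact Finsupp.sum_congr fun s _ => Finsupp.sum_mapDomain_index (by simp) (by simp [mul_add])

theorem gramForm_leftTranslate_left (a : A) :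
    gramForm L (leftTranslate Y B a v) w = gramForm L v (leftTranslate Y B (star a) w) := by
  rw [gramForm_leftTranslate_right, gramForm_apply, leftTranslate_apply,
    Finsupp.sum_mapDomain_index (by simp) (by simp [add_mul, Finsupp.sum_add])]
  simp only [star_mul, mul_assoc]

theorem gramForm_leftTranslate_add (a a' : A) : gramForm L v (leftTranslate Y B (a + a') w) =
    gramForm L v (leftTranslate Y B a w) + gramForm L v (leftTranslate Y B a' w) := by
  simp only [gramForm_leftTranslate_right, ← Finsupp.sum_add, add_mul, mul_add, map_add]

theorem gramForm_leftTranslate_smul (z : ℂ) (a : A) :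
    gramForm L v (leftTranslate Y B (z • a) w) = z • gramForm L v (leftTranslate Y B a w) := by
  simp only [gramForm_leftTranslate_right, Finsupp.smul_sum, smul_mul_assoc, mul_smul_comm,
    map_smul]

end GramForm

variable [PartialOrder B]

/-- The functions `Y × A → B` of finite support, as the space on which the form of the completely
positive kernel `L` is the inner product. The proof of complete positivity is part of the type
because the seminorm depends on it. -/
@[nolint unusedArguments]
def PreSpace (L : CStarKernel Y A B) (_ : L.IsCompletelyPositive) : Type _ := Y × A →₀ B

namespace PreSpace

variable {L : CStarKernel Y A B} {hL : L.IsCompletelyPositive}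

noncomputable instance : AddCommGroup (PreSpace L hL) :=
  inferInstanceAs (AddCommGroup (Y × A →₀ B))

noncomputable instance : Module ℂ (PreSpace L hL) := inferInstanceAs (Module ℂ (Y × A →₀ B))

noncomputable instance : Module Bᵐᵒᵖ (PreSpace L hL) :=
  inferInstanceAs (Module Bᵐᵒᵖ (Y × A →₀ B))

variable (L hL) in
/-- The identification of a function with an element of `PreSpace L hL`. -/
noncomputable def of : (Y × A →₀ B) ≃ₗ[ℂ] PreSpace L hL := LinearEquiv.refl ℂ _

variable (L hL) in
/-- The form of `L`, on `PreSpace L hL`. -/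
noncomputable def form : PreSpace L hL →ₗ⋆[ℂ] PreSpace L hL →ₗ[ℂ] B := gramForm L

variable (L hL) in
/-- The action of `a`, on `PreSpace L hL`. -/
noncomputable def act (a : A) : PreSpace L hL →ₗ[ℂ] PreSpace L hL := leftTranslate Y B a

theorem form_self_nonneg (v : PreSpace L hL) : 0 ≤ form L hL v v := gramForm_self_nonneg L v hL

theorem act_one (v : PreSpace L hL) : act L hL 1 v = v := leftTranslate_one v

theorem act_mul (a a' : A) (v : PreSpace L hL) :
    act L hL (a * a') v = act L hL a (act L hL a' v) := leftTranslate_mul v a a'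

theorem form_act_left (a : A) (v w : PreSpace L hL) :
    form L hL (act L hL a v) w = form L hL v (act L hL (star a) w) :=
  gramForm_leftTranslate_left L v w a

theorem form_act_add (a a' : A) (v w : PreSpace L hL) : form L hL v (act L hL (a + a') w) =
    form L hL v (act L hL a w) + form L hL v (act L hL a' w) :=
  gramForm_leftTranslate_add L v w a a'

theorem form_act_smul (z : ℂ) (a : A) (v w : PreSpace L hL) :
    form L hL v (act L hL (z • a) w) = z • form L hL v (act L hL a w) :=
  gramForm_leftTranslate_smul L v w z a

variable [StarOrderedRing B]

noncomputable instance : Norm (PreSpace L hL) := ⟨fun v => √‖form L hL v v‖⟩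

/-- The inner product is that of a left `Bᵐᵒᵖ`-module, with its values in `Bᵐᵒᵖ`. -/
noncomputable instance : PreCStarModule Bᵐᵒᵖ (PreSpace L hL) where
  inner v w := op (form L hL v w)
  inner_add_right v w w' := by rw [map_add, op_add]
  inner_self_nonneg v := form_self_nonneg v
  inner_smul_right c v w := by
    exact congrArg op (gramForm_op_smul_right L v w (unop c))
  inner_smul_right_complex z v w := by rw [map_smul, op_smul]
  star_inner v w := by
    rw [← op_star, (form L hL).star_apply_of_nonneg form_self_nonneg]
  norm_eq_sqrt_norm_inner_self v := rfl

noncomputable instance : SeminormedAddCommGroup (PreSpace L hL) :=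
  .ofCore (PreCStarModule.seminormedSpaceCore Bᵐᵒᵖ _)

noncomputable instance : NormedSpace ℂ (PreSpace L hL) where
  norm_smul_le z v :=
    ((PreCStarModule.seminormedSpaceCore Bᵐᵒᵖ (PreSpace L hL)).norm_smul z v).le

theorem norm_sq_eq (v : PreSpace L hL) : ‖v‖ ^ 2 = ‖form L hL v v‖ :=
  PreCStarModule.norm_sq_eq Bᵐᵒᵖ v

theorem norm_act_le (a : A) (v : PreSpace L hL) : ‖act L hL a v‖ ≤ ‖a‖ * ‖v‖ := by
  let φ : A →ₗ[ℂ] B :=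
    { toFun := fun c => form L hL v (act L hL c v)
      map_add' := fun c d => form_act_add c d v v
      map_smul' := fun z c => form_act_smul z c v v }
  have hφ (c : A) : φ (star c * c) = form L hL (act L hL c v) (act L hL c v) := by
    rw [form_act_left, ← act_mul]; rfl
  have h1 : φ 1 = form L hL v v := congrArg (form L hL v) (act_one v)
  have h := φ.map_star_mul_self_le (fun c => (hφ c).symm ▸ form_self_nonneg _) a
  rw [hφ, h1] at h
  have h2 := CStarAlgebra.norm_le_norm_of_nonneg_of_le (form_self_nonneg _) h
  rw [norm_smul, ← norm_sq_eq, ← norm_sq_eq, norm_pow, norm_norm, ← mul_pow] at h2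
  exact (pow_le_pow_iff_left₀ (norm_nonneg _) (by positivity) two_ne_zero).mp h2

theorem coe_eq_coe_of_form_eq {v w : PreSpace L hL}
    (h : ∀ u, form L hL u v = form L hL u w) : (v : Completion (PreSpace L hL)) = w := by
  rw [← sub_eq_zero, ← Completion.coe_sub, ← norm_eq_zero, Completion.norm_coe,
    ← pow_eq_zero_iff two_ne_zero, norm_sq_eq, map_sub _ v w, h, sub_self, norm_zero]

variable (L hL) in
/-- The action of `a` on the completion. -/
noncomputable def actCompletion (a : A) :
    Completion (PreSpace L hL) →L[ℂ] Completion (PreSpace L hL) :=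
  ((act L hL a).mkContinuous ‖a‖ (norm_act_le a)).completion

theorem actCompletion_coe (a : A) (v : PreSpace L hL) :
    actCompletion L hL a v = (act L hL a v : PreSpace L hL) :=
  ContinuousLinearMap.completion_apply_coe _ _

theorem completion_ext {S T : Completion (PreSpace L hL) →L[ℂ] Completion (PreSpace L hL)}
    (h : ∀ v : PreSpace L hL, S v = T v) : S = T := by
  ext e
  exact Completion.induction_on e (isClosed_eq S.continuous T.continuous) h

variable (L hL) in
/-- The action of `A` on the completion, as a homomorphism of algebras. Additivity holds because
`(a + a') · v` and `a · v + a' · v` have the same inner product with every vector. -/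
noncomputable def actHom :
    A →ₐ[ℂ] (Completion (PreSpace L hL) →L[ℂ] Completion (PreSpace L hL)) :=
  AlgHom.ofLinearMap
    { toFun := actCompletion L hL
      map_add' := fun a a' => completion_ext fun v => by
        rw [_root_.add_apply, actCompletion_coe, actCompletion_coe,
          actCompletion_coe, ← Completion.coe_add]
        exact coe_eq_coe_of_form_eq fun u => by rw [form_act_add, map_add]
      map_smul' := fun z a => completion_ext fun v => by
        rw [RingHom.id_apply, _root_.smul_apply, actCompletion_coe,
          actCompletion_coe, ← Completion.coe_smul]
        exact coe_eq_coe_of_form_eq fun u => by rw [form_act_smul, map_smul] }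
    (completion_ext fun v => (actCompletion_coe 1 v).trans (by rw [act_one]; rfl))
    (fun a a' => completion_ext fun v => by
      rw [mul_apply_eq_comp]
      exact (actCompletion_coe _ v).trans (by
        rw [act_mul, ← actCompletion_coe, ← actCompletion_coe]; rfl))

noncomputable instance : Module A (Completion (PreSpace L hL)) :=
  Module.compHom _ (actHom L hL).toRingHom

theorem smul_coe (a : A) (v : PreSpace L hL) :
    a • (v : Completion (PreSpace L hL)) = (act L hL a v : PreSpace L hL) :=
  actCompletion_coe a v

theorem continuous_smul (a : A) : Continuous fun e : Completion (PreSpace L hL) => a • e :=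
  (actCompletion L hL a).continuous

theorem rightInner_coe (v w : PreSpace L hL) :
    rightInner B (v : Completion (PreSpace L hL)) (w : Completion (PreSpace L hL)) =
      form L hL w v :=
  congrArg unop (PreCStarModule.inner_coe (C := Bᵐᵒᵖ) w v)

theorem continuous_rightInner {α : Type*} [TopologicalSpace α]
    {f g : α → Completion (PreSpace L hL)} (hf : Continuous f) (hg : Continuous g) :
    Continuous fun x => rightInner B (f x) (g x) :=
  MulOpposite.continuous_unop.comp
    (PreCStarModule.continuous_inner_completion_comp (C := Bᵐᵒᵖ) hg hf)

instance : CStarCorrespondence A B (Completion (PreSpace L hL)) where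
  smul_assoc z a e := DFunLike.congr_fun (map_smul (actHom L hL) z a) e
  rightInner_smul a x y :=
    Completion.induction_on₂ x y (isClosed_eq
      (continuous_rightInner ((continuous_smul a).comp continuous_fst) continuous_snd)
      (continuous_rightInner continuous_fst ((continuous_smul (star a)).comp continuous_snd)))
      fun v w => by
        rw [smul_coe, smul_coe, rightInner_coe, rightInner_coe, form_act_left, star_star]

end PreSpace

end CStarKernel

namespace CStarKernel

open MulOpposite UniformSpace WithCStarModule

/-! ### The shift on the double of a correspondence -/

section Shift

variable {A B E : Type*} [CStarAlgebra A] [CStarAlgebra B] [PartialOrder B] [StarOrderedRing B]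
  [NormedAddCommGroup E] [NormedSpace ℂ E] [Module Bᵐᵒᵖ E] [CStarModule Bᵐᵒᵖ E] [Module A E]
  [CStarCorrespondence A B E]

theorem rightInner_prod (x y : C⋆ᵐᵒᵈ(Bᵐᵒᵖ, E × E)) :
    rightInner B x y = rightInner B x.1 y.1 + rightInner B x.2 y.2 := rfl

instance : CStarCorrespondence A B C⋆ᵐᵒᵈ(Bᵐᵒᵖ, E × E) where
  rightInner_smul a x y := by
    have : CompleteSpace E := CStarCorrespondence.toCompleteSpace A B
    rw [rightInner_prod, rightInner_prod]
    exact congrArg₂ (· + ·) (CStarCorrespondence.rightInner_smul a x.1 y.1)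
      (CStarCorrespondence.rightInner_smul a x.2 y.2)

variable (B E) in
/-- The shift `(u, v) ↦ (0, u)` on `E ⊕ E`. -/
noncomputable def shift : C⋆ᵐᵒᵈ(Bᵐᵒᵖ, E × E) →L[ℂ] C⋆ᵐᵒᵈ(Bᵐᵒᵖ, E × E) :=
  LinearMap.mkContinuous
    { toFun := fun e => (equiv Bᵐᵒᵖ (E × E)).symm (0, e.1)
      map_add' := fun e e' => by
        rw [← equiv_symm_add, Prod.mk_add_mk, add_zero]; rfl
      map_smul' := fun z e => by
        rw [RingHom.id_apply, ← equiv_symm_smul, Prod.smul_mk, smul_zero]; rfl }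
    1 fun e => by
      rw [one_mul]
      refine le_trans (le_of_eq ?_) ((le_max_left _ _).trans (max_le_prod_norm e))
      rw [CStarModule.norm_eq_sqrt_norm_inner_self (A := Bᵐᵒᵖ) e.1]
      refine congrArg (fun c : Bᵐᵒᵖ => √‖c‖) ?_
      exact (congrArg (· + ⟪e.1, e.1⟫_Bᵐᵒᵖ) CStarModule.inner_zero_left).trans (zero_add _)

theorem shift_apply (e : C⋆ᵐᵒᵈ(Bᵐᵒᵖ, E × E)) :
    shift B E e = (equiv Bᵐᵒᵖ (E × E)).symm (0, e.1) := rfl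

end Shift

/-- On `E ⊕ E` with the map `x ↦ (f x, g x)`, the shift pairs the second component at `y` with the
first at `x`. Its adjoint is `(u, v) ↦ (v, 0)`. -/
theorem hasKolmogorovDecomposition_of_rightInner {X : Type u} {A : Type v} {B : Type w}
    [CStarAlgebra A] [CStarAlgebra B] [PartialOrder B] [StarOrderedRing B] {E : Type t}
    [NormedAddCommGroup E] [NormedSpace ℂ E] [Module Bᵐᵒᵖ E] [CStarModule Bᵐᵒᵖ E] [Module A E]
    [CStarCorrespondence A B E] {k : CStarKernel X A B} (f g : X → E)
    (hk : ∀ x y a, k x y a = rightInner B (a • g y) (f x)) :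
    HasKolmogorovDecomposition.{u, v, w, t} k := by
  refine ⟨C⋆ᵐᵒᵈ(Bᵐᵒᵖ, E × E), inferInstance, inferInstance, inferInstance, inferInstance,
    inferInstance, inferInstance, shift B E, fun x => (equiv _ _).symm (f x, g x),
    ⟨fun e => (equiv _ _).symm (e.2, 0), fun e e' => ?_⟩,
    LinearMap.mkContinuous_norm_le _ zero_le_one _, fun a e => ?_, fun x y a => ?_⟩
  · simp only [rightInner_prod, shift_apply, equiv_symm_fst, equiv_symm_snd, rightInner_zero_left,
      rightInner_zero_right, zero_add, add_zero]
  · rw [shift_apply, shift_apply, ← equiv_symm_smul, Prod.smul_mk, smul_zero]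
    rfl
  · rw [hk, rightInner_prod, shift_apply, equiv_symm_fst, equiv_symm_snd, rightInner_zero_right,
      zero_add]
    rfl

/-- The Kolmogorov decomposition of a completely positive kernel, with `ι(y) = δ₍y, 1₎ 1`. -/
theorem IsCompletelyPositive.exists_correspondence {Y : Type u} {A : Type v} {B : Type w}
    [CStarAlgebra A] [CStarAlgebra B] [PartialOrder B] [StarOrderedRing B] {L : CStarKernel Y A B}
    (hL : L.IsCompletelyPositive) :
    ∃ (E : Type max u v w) (_ : NormedAddCommGroup E) (_ : NormedSpace ℂ E) (_ : Module Bᵐᵒᵖ E)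
      (_ : CStarModule Bᵐᵒᵖ E) (_ : Module A E) (_ : CStarCorrespondence A B E) (ι : Y → E),
      ∀ x y a, L x y a = rightInner B (a • ι y) (ι x) := by
  refine ⟨Completion (PreSpace L hL), inferInstance, inferInstance, inferInstance, inferInstance,
    inferInstance, inferInstance, fun y => (PreSpace.of L hL (Finsupp.single (y, 1) 1) :), ?_⟩
  intro x y a
  rw [PreSpace.smul_coe, PreSpace.rightInner_coe]
  have h : leftTranslate Y B a (Finsupp.single (y, 1) 1) = Finsupp.single (y, a) 1 := by
    rw [leftTranslate_apply, Finsupp.mapDomain_single, mul_one]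
  change _ = gramForm L (Finsupp.single (x, 1) 1) (leftTranslate Y B a (Finsupp.single (y, 1) 1))
  rw [h, gramForm_single_single, star_one, star_one, one_mul, one_mul, mul_one]

/-- The entries of a completely positive `2 × 2` block kernel on `X` form a completely positive
`B`-valued kernel on `X × Fin 2`. The lift only adjusts the universe of the index set. -/
theorem IsCompletelyPositive.entries {X A B : Type*} [CStarAlgebra A] [CStarAlgebra B]
    [PartialOrder B] [StarOrderedRing B] {k : Fin 2 → Fin 2 → CStarKernel X A B}
    (hk : (block (k 0 0) (k 0 1) (k 1 0) (k 1 1)).IsCompletelyPositive) :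
    IsCompletelyPositive (B := B) fun s t : ULift.{t} (X × Fin 2) =>
      k s.down.2 t.down.2 s.down.1 t.down.1 := by
  intro n s a b
  -- `C i` has `b i` in the row of the index of `s i` and the column `0`, and zeros elsewhere: the
  -- required sum is the `(0, 0)` entry of the one for the block kernel.
  let C : Fin n → CStarMatrix (Fin 2) (Fin 2) B := fun i =>
    CStarMatrix.ofMatrix fun p q => if p = (s i).down.2 ∧ q = 0 then b i else 0
  have hb (x y : X) (a : A) : block (k 0 0) (k 0 1) (k 1 0) (k 1 1) x y a =
      CStarMatrix.ofMatrix fun p q => k p q x y a := by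
    rw [block_apply]
    ext p q
    fin_cases p <;> fin_cases q <;> rfl
  have h := CStarMatrix.diagonal_nonneg (hk n (fun i => (s i).down.1) a C) 0
  rw [CStarMatrix.sum_apply] at h
  refine h.trans_eq (Finset.sum_congr rfl fun i _ => ?_)
  rw [CStarMatrix.sum_apply]
  refine Finset.sum_congr rfl fun j _ => ?_
  have hC (i : Fin n) (p : Fin 2) : C i p 0 = if p = (s i).down.2 then b i else 0 := by
    change (if p = (s i).down.2 ∧ (0 : Fin 2) = 0 then b i else 0) = _
    simp
  rw [hb, CStarMatrix.mul_apply]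
  simp only [CStarMatrix.mul_apply, CStarMatrix.star_apply, hC, mul_ite, mul_zero,
    Finset.sum_ite_eq', Finset.mem_univ, if_true]
  rw [Finset.sum_eq_single (s i).down.2 (fun p _ hp => by rw [if_neg hp, star_zero, zero_mul])
    (fun hp => absurd (Finset.mem_univ _) hp), if_pos rfl]
  rfl

end CStarKernel

theorem mainTheorem3 {X : Type u} {A : Type v} {B : Type w}
    [CStarAlgebra A] [CStarAlgebra B] [PartialOrder B] [StarOrderedRing B]
    (k : CStarKernel X A B) :
    CStarKernel.HasKolmogorovDecomposition.{u, v, w, max u v w t} k ↔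
      ∃ L₁ L₂ : CStarKernel X A B,
        L₁.IsCompletelyPositive ∧ L₂.IsCompletelyPositive ∧
          (CStarKernel.block L₁ k (CStarKernel.adjoint k) L₂).IsCompletelyPositive := by
  refine ⟨fun h => h.exists_block, ?_⟩
  rintro ⟨L₁, L₂, -, -, h⟩
  obtain ⟨E, _, _, _, _, _, _, ι, hι⟩ :=
    (CStarKernel.IsCompletelyPositive.entries.{t}
      (k := ![![L₁, k], ![k.adjoint, L₂]]) h).exists_correspondence
  exact CStarKernel.hasKolmogorovDecomposition_of_rightInner
    (fun x => ι ⟨(x, 0)⟩) (fun x => ι ⟨(x, 1)⟩) fun x y a => hι ⟨(x, 0)⟩ ⟨(y, 1)⟩ a
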